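/- Let $G$ be a finite soluble group and let $n>1$ be an integer. A subgroup $M$ of $G$ is called $n$-maximal if there is a chain $M=M_n<M_{n-1}<\dots<M_1<M_0=G$ in which $M_i$ is a maximal subgroup of $M_{i-1}$ for every $i=1,\dots,n$. A subgroup $H$ of $G$ is called $S$-quasinormal in $G$ if $HP=PH$ for every Sylow subgroup $P$ of $G$. The rank $r(G)$ is the largest integer $k$ such that $G$ has a chief factor of order $p^k$ for some prime $p$ (with $r(G)=0$ if $G$ is trivial). If every $n$-maximal subgroup of $G$ is $S$-quasinormal in $G$, then $r(G)\le n-1$. -/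

import Mathlib

open scoped Pointwise

namespace SQuasi

/-- `H` is an `n`-maximal subgroup of `G`: there is a chain `H = Mₙ < ⋯ < M₁ < M₀ = G` in which
each `Mᵢ₊₁` is a maximal subgroup of `Mᵢ`, that is, `Mᵢ₊₁ < Mᵢ` with no subgroup strictly in
between. (Only the values `M 0, …, M n` matter.) -/
def IsNMaximal {G : Type*} [Group G] (n : ℕ) (H : Subgroup G) : Prop :=
  ∃ M : ℕ → Subgroup G, M 0 = ⊤ ∧ M n = H ∧ ∀ i < n, M (i + 1) ⋖ M i

/-- `H` is `S`-quasinormal in `G`: `HP = PH` for every Sylow subgroup `P` of `G`. -/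
def IsSQuasinormal {G : Type*} [Group G] (H : Subgroup G) : Prop :=
  ∀ p : ℕ, p.Prime → ∀ P : Sylow p G, (H : Set G) * (P : Set G) = (P : Set G) * (H : Set G)

/-- `H / K` is a chief factor of `G`: `K < H` are normal subgroups of `G` and no normal subgroup
of `G` lies strictly between them. -/
structure IsChiefFactor {G : Type*} [Group G] (K H : Subgroup G) : Prop where
  normal_bot : K.Normal
  normal_top : H.Normal
  lt : K < H
  eq_or_eq : ∀ N : Subgroup G, N.Normal → K ≤ N → N ≤ H → N = K ∨ N = H

/-- The set of all `k` such that `G` has a chief factor `H / K` of order `p ^ k` for some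
prime `p`. -/
def chiefExponents (G : Type*) [Group G] : Set ℕ :=
  {k | ∃ p : ℕ, p.Prime ∧ ∃ K H : Subgroup G, IsChiefFactor K H ∧ K.relIndex H = p ^ k}

/-- For a finite group the set of exponents is bounded, so its supremum is meaningful. -/
theorem bddAbove_chiefExponents (G : Type*) [Group G] [Finite G] :
    BddAbove (chiefExponents G) := by
  refine ⟨Nat.card G, ?_⟩
  rintro k ⟨p, hp, K, H, -, h⟩
  have h1 : p ^ k ≤ Nat.card G := by
    rw [← h]
    exact (Nat.le_of_dvd Nat.card_pos (Subgroup.relIndex_dvd_card K H)).trans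
      (Subgroup.card_le_card_group H)
  exact (Nat.lt_pow_self hp.one_lt).le.trans h1

/-- The rank `r(G)` of a finite soluble group: the largest `k` such that `G` has a chief factor
of order `p ^ k` for some prime `p` (and `0` for the trivial group, which has no chief factor). -/
noncomputable def rank (G : Type*) [Group G] : ℕ :=
  sSup (chiefExponents G)

end SQuasi

/-!
It suffices to bound the chief factors of `G`. By induction on `|G|` a chief factor `H / K` of order
`p ^ k` with `K ≠ 1` is handled in `G / K`, so let `N` be a minimal normal subgroup of order
`p ^ k`, and let `C` be its centraliser, which contains every normal subgroup of `G` of prime power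
order. If `C = G` then `k = 1`. Otherwise some maximal subgroup `M` does not contain `C`
(`IsChiefFactor.exists_coatom_not_le`, a Frattini argument using solubility).

* If `N ≤ M`, then `G = M C`, so `N` is minimal normal in `M`. The `(n - 1)`-maximal subgroups of
  `M` are `S`-quasinormal in `M`, and induction gives `k ≤ max 1 (n - 2)`. The induction starts at
  `n = 1`, where all maximal subgroups are normal and `G` is nilpotent.
* If `N` is not contained in `M`, then `M` is a complement of `N`. The chief factor `N` may be
  replaced by `N D / D` with `D = M ∩ C`, so let `D = 1`. Refine `M ≥ K ≥ 1` to a chain, with `K` a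
  nontrivial normal `q`-subgroup of `M`; here `q ≠ p`. Suppose the chain has length at least `n`.
  Its term that is `n`-maximal in `G` then contains a nontrivial `q`-element `x` of `K`. An
  `S`-quasinormal subgroup contains the `q`-elements of any overgroup in which its index is a power
  of `p` (`IsSQuasinormal.mem_of_relIndex_eq_pow`), so it contains the `N`-conjugates of `x`, which
  forces `x` to centralise `N`, a contradiction. Hence there is a chain of length less than `n` from
  `G` to `N`. It can be continued below `N` to an `n`-maximal subgroup `L < N` normalised by a Sylow
  `p`-subgroup of `G`. Being `S`-quasinormal, `L` is normalised by all other Sylow subgroups too, so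
  it is normal in `G` and trivial, and therefore `k < n` (`IsChiefFactor.lt_of_coverChain`).
-/

open scoped Pointwise

namespace SQuasi

/-! ### Chains of covering relations -/

/-- `CoverChain j a b`: there is a chain `a = x₀ ⋗ x₁ ⋗ ⋯ ⋗ xⱼ = b` in which every step is a
covering relation. With `a = ⊤` in the lattice of subgroups this is `IsNMaximal j b`. -/
def CoverChain {α : Type*} [PartialOrder α] (j : ℕ) (a b : α) : Prop :=
  ∃ x : ℕ → α, x 0 = a ∧ x j = b ∧ ∀ i < j, x (i + 1) ⋖ x i

namespace CoverChain

variable {α β : Type*} [PartialOrder α] [PartialOrder β]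

theorem refl (a : α) : CoverChain 0 a a :=
  ⟨fun _ => a, rfl, rfl, fun _ h => absurd h (Nat.not_lt_zero _)⟩

theorem of_covBy {a b : α} (h : b ⋖ a) : CoverChain 1 a b :=
  ⟨fun i => if i = 0 then a else b, by simp, by simp, fun i hi => by
    obtain rfl : i = 0 := by omega
    simpa using h⟩

theorem trans {i j : ℕ} {a b c : α} (h₁ : CoverChain i a b) (h₂ : CoverChain j b c) :
    CoverChain (i + j) a c := by
  obtain ⟨x, hx0, hxi, hx⟩ := h₁
  obtain ⟨y, hy0, hyj, hy⟩ := h₂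
  refine ⟨fun k => if k < i then x k else y (k - i), ?_, by simpa using hyj, fun k hk => ?_⟩
  · by_cases hi : 0 < i
    · simpa [hi] using hx0
    · obtain rfl : i = 0 := by omega
      simp [hy0, ← hxi, hx0]
  · by_cases h1 : k + 1 < i
    · simpa [h1, (by omega : k < i)] using hx k (by omega)
    · by_cases h2 : k < i
      · obtain rfl : i = k + 1 := by omega
        simpa [hy0, ← hxi] using hx k (by omega)
      · have := hy (k - i) (by omega)
        simpa [h1, h2, (by omega : k + 1 - i = k - i + 1)] using this

theorem split {i j : ℕ} {a c : α} (h : CoverChain (i + j) a c) :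
    ∃ b, CoverChain i a b ∧ CoverChain j b c := by
  obtain ⟨x, hx0, hxj, hx⟩ := h
  exact ⟨x i, ⟨x, hx0, rfl, fun k hk => hx k (by omega)⟩,
    ⟨fun k => x (i + k), rfl, hxj, fun k hk => hx (i + k) (by omega)⟩⟩

theorem le {j : ℕ} {a b : α} (h : CoverChain j a b) : b ≤ a := by
  obtain ⟨x, rfl, rfl, hx⟩ := h
  induction j with
  | zero => exact le_rfl
  | succ j ih => exact (hx j (by omega)).le.trans (ih fun i hi => hx i (by omega))

theorem lt {j : ℕ} {a b : α} (hj : j ≠ 0) (h : CoverChain j a b) : b < a := by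
  obtain ⟨j, rfl⟩ := Nat.exists_eq_succ_of_ne_zero hj
  rw [Nat.succ_eq_one_add] at h
  obtain ⟨c, ⟨x, rfl, rfl, hx⟩, hc⟩ := split h
  exact hc.le.trans_lt (hx 0 one_pos).lt

theorem map {j : ℕ} {a b : α} (f : α → β) (hf : ∀ x y, x ⋖ y → y ≤ a → f x ⋖ f y)
    (h : CoverChain j a b) : CoverChain j (f a) (f b) := by
  obtain ⟨x, rfl, rfl, hx⟩ := h
  exact ⟨f ∘ x, rfl, rfl, fun i hi => hf _ _ (hx i hi)
    (le ⟨x, rfl, rfl, fun k hk => hx k (hk.trans hi)⟩)⟩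

theorem exists_of_le [Finite α] {a b : α} (h : b ≤ a) : ∃ j, CoverChain j a b := by
  induction a using WellFoundedLT.induction with
  | ind a ih =>
    rcases h.eq_or_lt with rfl | h
    · exact ⟨0, refl _⟩
    · obtain ⟨c, hbc, hca⟩ := exists_le_covBy_of_lt h
      obtain ⟨j, hj⟩ := ih c hca.lt hbc
      exact ⟨1 + j, (of_covBy hca).trans hj⟩

end CoverChain

/-! ### Subgroup lattice covers -/

section Covers

variable {G : Type*} [Group G]

theorem covBy_comap {G' : Type*} [Group G'] {f : G →* G'} (hf : Function.Surjective f)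
    {A B : Subgroup G'} (h : A ⋖ B) : A.comap f ⋖ B.comap f := by
  refine ⟨(Subgroup.comap_lt_comap_of_surjective hf).2 h.lt, fun X h1 h2 => ?_⟩
  have hX : (X.map f).comap f = X := by
    refine Subgroup.comap_map_eq_self ((MonoidHom.ker_le_comap f A).trans h1.le)
  rw [← hX, Subgroup.comap_lt_comap_of_surjective hf] at h1 h2
  exact h.2 h1 h2

theorem covBy_map_subtype {M : Subgroup G} {A B : Subgroup M} (h : A ⋖ B) :
    A.map M.subtype ⋖ B.map M.subtype := by
  refine ⟨(Subgroup.map_lt_map_iff_of_injective M.subtype_injective).2 h.lt, fun X h1 h2 => ?_⟩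
  have hX : (X.subgroupOf M).map M.subtype = X := by
    rw [Subgroup.subgroupOf_map_subtype]
    exact inf_eq_left.2 (h2.le.trans (Subgroup.map_subtype_le B))
  rw [← hX, Subgroup.map_lt_map_iff_of_injective M.subtype_injective] at h1 h2
  exact h.2 h1 h2

/-- If `M` is a complement of the normal subgroup `N`, then `X ↦ X ⊔ N` is injective on the
subgroups of `M` and preserves covering. -/
theorem covBy_sup_of_disjoint {M N : Subgroup G} [N.Normal] (hMN : M ⊓ N = ⊥)
    {X Y : Subgroup G} (hY : Y ≤ M) (h : X ⋖ Y) : X ⊔ N ⋖ Y ⊔ N := by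
  have key : ∀ Z ≤ M, ∀ z ∈ M, z ∈ Z ⊔ N → z ∈ Z := by
    intro Z hZ z hz hzN
    obtain ⟨a, ha, b, hb, rfl⟩ := Subgroup.mem_sup_of_normal_right.1 hzN
    have : b ∈ M ⊓ N := ⟨by simpa using M.mul_mem (M.inv_mem (hZ ha)) hz, hb⟩
    rw [hMN, Subgroup.mem_bot] at this
    simpa [this] using ha
  have modular : ∀ W : Subgroup G, N ≤ W → W ≤ Y ⊔ N → W = (W ⊓ Y) ⊔ N := by
    intro W hNW hW
    refine le_antisymm (fun w hw => ?_) (sup_le inf_le_left hNW)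
    obtain ⟨a, ha, b, hb, rfl⟩ := Subgroup.mem_sup_of_normal_right.1 (hW hw)
    exact Subgroup.mul_mem_sup ⟨by simpa using W.mul_mem hw (W.inv_mem (hNW hb)), ha⟩ hb
  have hX : X ≤ M := h.le.trans hY
  refine ⟨lt_of_le_not_ge (sup_le_sup_right h.le N) fun hle => ?_, fun W h1 h2 => ?_⟩
  · exact h.lt.not_ge fun y hy => key X hX y (hY hy) (hle (Subgroup.mem_sup_left hy))
  · have hW := modular W (le_sup_right.trans h1.le) h2.le
    have hXW : X ≤ W ⊓ Y := le_inf (le_sup_left.trans h1.le) h.le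
    rcases h.eq_or_eq hXW inf_le_right with h3 | h3
    · rw [h3] at hW; exact h1.ne' hW
    · rw [h3] at hW; exact h2.ne hW

theorem covBy_of_relIndex_prime {A B : Subgroup G} (hAB : A ≤ B) (h : (A.relIndex B).Prime) :
    A ⋖ B := by
  refine ⟨lt_of_le_of_ne hAB fun e => ?_, fun X h1 h2 => ?_⟩
  · subst e; simp [Nat.not_prime_one] at h
  · have := Subgroup.relIndex_mul_relIndex _ _ _ h1.le h2.le
    rw [← this] at h
    rcases Nat.prime_mul_iff.1 h with ⟨-, h⟩ | ⟨-, h⟩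
    · exact h2.not_ge (Subgroup.relIndex_eq_one.1 h)
    · exact h1.not_ge (Subgroup.relIndex_eq_one.1 h)

end Covers

/-! ### `S`-quasinormal subgroups -/

section SQuasinormal

variable {G : Type*} [Group G]

theorem IsSQuasinormal.map {G' : Type*} [Group G'] [Finite G] {f : G →* G'}
    (hf : Function.Surjective f) {H : Subgroup G} (hH : IsSQuasinormal H) :
    IsSQuasinormal (H.map f) := by
  intro p hp P'
  have : Fact p.Prime := ⟨hp⟩
  obtain ⟨P, rfl⟩ := Sylow.mapSurjective_surjective hf p P'
  have h := hH p hp P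
  have h2 := congrArg (fun s : Set G => f '' s) h
  simp only [Set.image_mul] at h2
  have e : ((P.mapSurjective hf : Subgroup G') : Set G') = f '' (P : Set G) := by
    rw [Sylow.coe_mapSurjective]; rfl
  change ((H.map f : Subgroup G') : Set G') * ((P.mapSurjective hf : Subgroup G') : Set G') =
    ((P.mapSurjective hf : Subgroup G') : Set G') * ((H.map f : Subgroup G') : Set G')
  rwa [e, Subgroup.coe_map]

theorem IsSQuasinormal.subgroupOf [Finite G] {H M : Subgroup G} (hHM : H ≤ M)
    (hH : IsSQuasinormal H) : IsSQuasinormal (H.subgroupOf M) := by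
  intro p hp Q
  have : Fact p.Prime := ⟨hp⟩
  obtain ⟨P, hP⟩ := Sylow.exists_comap_subtype_eq Q
  have hQ : ∀ x : M, x ∈ Q ↔ (x : G) ∈ P := fun x => by
    change x ∈ (Q : Subgroup M) ↔ _
    rw [← hP]; rfl
  have h := hH p hp P
  ext x
  simp only [Set.mem_mul, SetLike.mem_coe, Subgroup.mem_subgroupOf, hQ]
  constructor
  · rintro ⟨a, ha, b, hb, rfl⟩
    have : (a * b : G) ∈ (P : Set G) * (H : Set G) := h ▸ Set.mul_mem_mul ha hb
    obtain ⟨c, hc, d, hd, hcd⟩ := Set.mem_mul.1 this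
    have hcM : c ∈ M := by
      rw [eq_mul_inv_of_mul_eq hcd]
      exact M.mul_mem (M.mul_mem a.2 b.2) (M.inv_mem (hHM hd))
    exact ⟨⟨c, hcM⟩, hc, ⟨d, hHM hd⟩, hd, Subtype.ext hcd⟩
  · rintro ⟨a, ha, b, hb, rfl⟩
    have : (a * b : G) ∈ (H : Set G) * (P : Set G) := h ▸ Set.mul_mem_mul ha hb
    obtain ⟨c, hc, d, hd, hcd⟩ := Set.mem_mul.1 this
    have hdM : d ∈ M := by
      rw [eq_inv_mul_of_mul_eq hcd]
      exact M.mul_mem (M.inv_mem (hHM hc)) (M.mul_mem a.2 b.2)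
    exact ⟨⟨c, hHM hc⟩, hc, ⟨d, hdM⟩, hd, Subtype.ext hcd⟩

/-- The product of an `S`-quasinormal subgroup `H` and a Sylow `q`-subgroup is a subgroup in which
`H` has `q`-power index. -/
theorem IsSQuasinormal.exists_sup_relIndex [Finite G] {H : Subgroup G} (hH : IsSQuasinormal H)
    {q : ℕ} (hq : q.Prime) (Q : Sylow q G) :
    ∃ T : Subgroup G, H ≤ T ∧ (Q : Subgroup G) ≤ T ∧ ∃ m, H.relIndex T = q ^ m := by
  have : Fact q.Prime := ⟨hq⟩
  have hcomm := hH q hq Q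
  let T : Subgroup G :=
    { carrier := (Q : Set G) * (H : Set G)
      one_mem' := ⟨1, Q.one_mem, 1, H.one_mem, by simp⟩
      mul_mem' := by
        rintro _ _ ⟨a, ha, b, hb, rfl⟩ ⟨c, hc, d, hd, rfl⟩
        have : b * c ∈ (Q : Set G) * (H : Set G) := hcomm ▸ Set.mul_mem_mul hb hc
        obtain ⟨c', hc', b', hb', h⟩ := Set.mem_mul.1 this
        refine ⟨a * c', Q.mul_mem ha hc', b' * d, H.mul_mem hb' hd, ?_⟩
        calc a * c' * (b' * d) = a * (c' * b') * d := by group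
          _ = a * b * (c * d) := by rw [h]; group
      inv_mem' := by
        rintro _ ⟨a, ha, b, hb, rfl⟩
        simp only [mul_inv_rev]
        exact hcomm ▸ Set.mul_mem_mul (H.inv_mem hb) (Q.inv_mem ha) }
  have hHT : H ≤ T := fun h hh => ⟨1, Q.one_mem, h, hh, by simp⟩
  refine ⟨T, hHT, fun x hx => ⟨x, hx, 1, H.one_mem, by simp⟩, ?_⟩
  have h1 := Subgroup.card_mul_eq_card_subgroup_mul_card_quotient H (Q : Set G)
  have h2 : (QuotientGroup.mk '' (Q : Set G) : Set (G ⧸ H)) =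
      MulAction.orbit (Q : Subgroup G) ((1 : G) : G ⧸ H) := by
    ext x
    constructor
    · rintro ⟨y, hy, rfl⟩
      exact ⟨⟨y, hy⟩, congrArg (QuotientGroup.mk (s := H)) (mul_one y)⟩
    · rintro ⟨y, rfl⟩
      exact ⟨y, y.2, congrArg (QuotientGroup.mk (s := H)) (mul_one (y : G)).symm⟩
  rw [h2] at h1
  obtain ⟨m, hm⟩ := Q.isPGroup'.card_orbit ((1 : G) : G ⧸ H)
  refine ⟨m, ?_⟩
  have h3 : Nat.card H * H.relIndex T = Nat.card T := by
    rw [← Subgroup.relIndex_bot_left, ← Subgroup.relIndex_bot_left]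
    exact Subgroup.relIndex_mul_relIndex _ _ _ bot_le hHT
  have h4 : Nat.card T = Nat.card ((Q : Set G) * (H : Set G) : Set G) := rfl
  rw [h4, h1, hm] at h3
  exact Nat.eq_of_mul_eq_mul_left Nat.card_pos h3

/-- If the `S`-quasinormal subgroup `H` has `p`-power index in `T`, it contains all elements of `T`
whose order is a power of a prime `q ≠ p`: inside `T`, the index of `H` in its product with a Sylow
`q`-subgroup is a power of both primes. -/
theorem IsSQuasinormal.mem_of_relIndex_eq_pow [Finite G] {H T : Subgroup G}
    (hH : IsSQuasinormal H) (hHT : H ≤ T) {p q k m : ℕ} (hp : p.Prime) (hq : q.Prime) (hpq : q ≠ p)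
    (hidx : H.relIndex T = p ^ k) {z : G} (hz : z ∈ T) (hzq : z ^ q ^ m = 1) : z ∈ H := by
  have : Fact q.Prime := ⟨hq⟩
  have hZ : IsPGroup q (Subgroup.zpowers z) :=
    IsPGroup.of_card_dvd_pow (n := m) (by rw [Nat.card_zpowers]; exact orderOf_dvd_of_pow_eq_one hzq)
  obtain ⟨Q, hQ⟩ := hZ.exists_le_sylow
  obtain ⟨U, hHU, hQU, l, hl⟩ := hH.exists_sup_relIndex hq Q
  have h1 : H.relIndex (U ⊓ T) ∣ q ^ l := hl ▸
    Dvd.intro _ (Subgroup.relIndex_mul_relIndex _ _ _ (le_inf hHU hHT) inf_le_left)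
  have h2 : H.relIndex (U ⊓ T) ∣ p ^ k := hidx ▸
    Dvd.intro _ (Subgroup.relIndex_mul_relIndex _ _ _ (le_inf hHU hHT) inf_le_right)
  have h3 : H.relIndex (U ⊓ T) = 1 :=
    Nat.eq_one_of_dvd_coprimes (Nat.coprime_pow_primes l k hq hp hpq) h1 h2
  exact Subgroup.relIndex_eq_one.1 h3 ⟨hQU (hQ (Subgroup.mem_zpowers z)), hz⟩

/-- An `S`-quasinormal subgroup `H` of a normal `p`-subgroup `N` is normalised by the Sylow
`q`-subgroups with `q ≠ p`. -/
theorem IsSQuasinormal.conj_mem {H N : Subgroup G} [N.Normal] {p q : ℕ} (hp : p.Prime)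
    (hq : q.Prime) (hpq : q ≠ p) (hN : IsPGroup p N) (hHN : H ≤ N) (hH : IsSQuasinormal H)
    (Q : Sylow q G) {x : G} (hx : x ∈ Q) {a : G} (ha : a ∈ H) : x * a * x⁻¹ ∈ H := by
  have : Fact p.Prime := ⟨hp⟩
  have : Fact q.Prime := ⟨hq⟩
  have h : x * a ∈ (H : Set G) * (Q : Set G) := (hH q hq Q) ▸ Set.mul_mem_mul hx ha
  obtain ⟨b, hb, y, hy, hby⟩ := Set.mem_mul.1 h
  have h1 : x * a * x⁻¹ = b * (y * x⁻¹) := by rw [← hby]; group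
  have h2 : y * x⁻¹ ∈ N := by
    have : y * x⁻¹ = b⁻¹ * (x * a * x⁻¹) := by rw [h1]; group
    rw [this]
    exact N.mul_mem (N.inv_mem (hHN hb)) (Subgroup.Normal.conj_mem inferInstance a (hHN ha) x)
  have h3 : y * x⁻¹ = 1 := Subgroup.disjoint_def.1
    (IsPGroup.disjoint_of_ne q p hpq _ _ Q.isPGroup' hN) (Q.mul_mem hy (Q.inv_mem hx)) h2
  rw [h1, h3, mul_one]
  exact hb

end SQuasinormal

/-! ### Chief factors and `p`-groups -/

section ChiefFactors

variable {G : Type*} [Group G]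

theorem eq_top_of_forall_sylow_le [Finite G] (X : Subgroup G)
    (h : ∀ q : ℕ, q.Prime → ∃ Q : Sylow q G, (Q : Subgroup G) ≤ X) : X = ⊤ := by
  by_contra hX
  obtain ⟨q, hq, hdvd⟩ := Nat.exists_prime_and_dvd (mt Subgroup.index_eq_one.1 hX)
  have : Fact q.Prime := ⟨hq⟩
  obtain ⟨Q, hQ⟩ := h q hq
  exact Q.not_dvd_index (hdvd.trans (Subgroup.index_dvd_of_le hQ))

/-- A `p`-subgroup acting by conjugation on a nontrivial normal `p`-subgroup has a nontrivial fixed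
point. -/
theorem inf_centralizer_ne_bot [Finite G] {p : ℕ} (hp : p.Prime) {N S : Subgroup G} [N.Normal]
    (hN : IsPGroup p N) (hN1 : N ≠ ⊥) (hS : IsPGroup p S) :
    N ⊓ Subgroup.centralizer (S : Set G) ≠ ⊥ := by
  have : Fact p.Prime := ⟨hp⟩
  let _ : MulAction S N :=
    MulAction.compHom N ((MulAut.conjNormal : G →* MulAut N).comp S.subtype)
  have hsmul : ∀ (s : S) (n : N), ((s • n : N) : G) = s * n * (s : G)⁻¹ := fun s n => rfl
  have hdvd : p ∣ Nat.card N := hN.card_eq_or_dvd.resolve_left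
    (mt Subgroup.card_eq_one.1 hN1)
  have hfix : (1 : N) ∈ MulAction.fixedPoints S N := fun s => Subtype.ext (by simp [hsmul])
  obtain ⟨b, hb, hb1⟩ := hS.exists_fixed_point_of_prime_dvd_card_of_fixed_point N hdvd hfix
  intro hbot
  have hmem : (b : G) ∈ N ⊓ Subgroup.centralizer (S : Set G) := by
    refine ⟨b.2, Subgroup.mem_centralizer_iff.2 fun s hs => ?_⟩
    have := congrArg (fun x : N => (x : G)) (hb ⟨s, hs⟩)
    simp only [hsmul] at this
    exact mul_inv_eq_iff_eq_mul.1 this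
  rw [hbot, Subgroup.mem_bot] at hmem
  exact hb1 (Subtype.ext hmem.symm)

theorem IsChiefFactor.eq_of_le {N X : Subgroup G} (hN : IsChiefFactor ⊥ N) (hX : X.Normal)
    (hXN : X ≤ N) (hX1 : X ≠ ⊥) : X = N :=
  (hN.eq_or_eq X hX bot_le hXN).resolve_left hX1

/-- A normal subgroup of prime power order centralises every minimal normal subgroup of prime power
order. -/
theorem IsChiefFactor.le_centralizer [Finite G] {N S : Subgroup G} (hN : IsChiefFactor ⊥ N)
    {p q : ℕ} (hp : p.Prime) (hq : q.Prime) (hNp : IsPGroup p N) (hS : S.Normal)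
    (hSq : IsPGroup q S) : S ≤ Subgroup.centralizer (N : Set G) := by
  have := hN.normal_top
  have : Fact p.Prime := ⟨hp⟩
  have : Fact q.Prime := ⟨hq⟩
  by_cases hpq : p = q
  · subst hpq
    have h := hN.eq_of_le inferInstance inf_le_left
      (inf_centralizer_ne_bot hp hNp hN.lt.ne' hSq)
    exact Subgroup.le_centralizer_iff.1 (inf_eq_left.1 h)
  · intro s hs
    exact Subgroup.mem_centralizer_iff.2 fun n hn => Subgroup.commute_of_normal_of_disjoint _ _
      hN.normal_top hS (IsPGroup.disjoint_of_ne p q hpq _ _ hNp hSq) n s hn hs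

theorem IsChiefFactor.map_mk {K H : Subgroup G} [K.Normal] (h : IsChiefFactor K H) :
    IsChiefFactor ⊥ (H.map (QuotientGroup.mk' K)) := by
  have hs := QuotientGroup.mk'_surjective K
  have hc : (H.map (QuotientGroup.mk' K)).comap (QuotientGroup.mk' K) = H :=
    Subgroup.comap_map_eq_self (by simpa using h.lt.le)
  have hb : (⊥ : Subgroup (G ⧸ K)).comap (QuotientGroup.mk' K) = K := by
    rw [MonoidHom.comap_bot, QuotientGroup.ker_mk']
  refine ⟨inferInstance, h.normal_top.map _ hs, ?_, fun N hN _ hNH => ?_⟩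
  · rw [← Subgroup.comap_lt_comap_of_surjective hs, hc, hb]
    exact h.lt
  · have h1 : K ≤ N.comap (QuotientGroup.mk' K) :=
      hb.symm.trans_le (Subgroup.comap_mono bot_le)
    have h2 : N.comap (QuotientGroup.mk' K) ≤ H :=
      (Subgroup.comap_mono hNH).trans hc.le
    refine (h.eq_or_eq _ (hN.comap _) h1 h2).imp (fun e => ?_) fun e => ?_
    · exact Subgroup.comap_injective hs (e.trans hb.symm)
    · exact Subgroup.comap_injective hs (e.trans hc.symm)

theorem card_map_mk (K H : Subgroup G) [K.Normal] :
    Nat.card (H.map (QuotientGroup.mk' K)) = K.relIndex H := by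
  rw [← Subgroup.relIndex_ker, QuotientGroup.ker_mk']

theorem IsChiefFactor.of_covBy_normal {K H : Subgroup G} (hK : K.Normal) (hH : H.Normal)
    (hlt : K < H) (h : ∀ N : Subgroup G, N.Normal → N < H → ¬ K < N) : IsChiefFactor K H := by
  refine ⟨hK, hH, hlt, fun N hN h1 h2 => ?_⟩
  rcases h1.eq_or_lt with e | h1
  · exact Or.inl e.symm
  · exact Or.inr (h2.eq_or_lt.resolve_right fun h2 => h N hN h2 h1)

/-- Chief factors of a finite `p`-group have order `p`. -/
theorem IsChiefFactor.relIndex_eq_of_isPGroup [Finite G] {p : ℕ} (hp : p.Prime)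
    (hG : IsPGroup p G) {K H : Subgroup G} (h : IsChiefFactor K H) : K.relIndex H = p := by
  have := h.normal_bot
  have : Fact p.Prime := ⟨hp⟩
  have h' := h.map_mk
  have := h'.normal_top
  rw [← card_map_mk]
  have hQ : IsPGroup p (G ⧸ K) := hG.to_quotient K
  obtain ⟨⟨x, hxH, hxc⟩, hx1⟩ := Subgroup.ne_bot_iff_exists_ne_one.1 (inf_centralizer_ne_bot hp
    (hQ.to_subgroup (H.map (QuotientGroup.mk' K))) h'.lt.ne' (hQ.to_subgroup ⊤))
  have hx1 : x ≠ 1 := fun e => hx1 (Subtype.ext e)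
  obtain ⟨m, hm⟩ := hQ.dvd_orderOf hx1
  have hm0 : m ≠ 0 := by rintro rfl; exact (orderOf_pos x).ne' (by simpa using hm)
  have hord : orderOf (x ^ m) = p := by
    rw [orderOf_pow_of_dvd hm0 (hm ▸ Dvd.intro_left _ rfl), hm,
      Nat.mul_div_cancel _ (Nat.pos_of_ne_zero hm0)]
  have hcomm : ∀ y, Commute y (x ^ m) := fun y =>
    (Commute.pow_right (Subgroup.mem_centralizer_iff.1 hxc y trivial : Commute y x) m)
  have hnorm : (Subgroup.zpowers (x ^ m)).Normal := by
    refine ⟨fun a ha g => ?_⟩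
    obtain ⟨i, rfl⟩ := Subgroup.mem_zpowers_iff.1 ha
    rw [((hcomm g).zpow_right i).eq, mul_inv_cancel_right]
    exact ha
  have heq := h'.eq_of_le hnorm (Subgroup.zpowers_le.2 (Subgroup.pow_mem _ hxH m)) (by
    rw [Ne, Subgroup.zpowers_eq_bot, ← orderOf_eq_one_iff, hord]
    exact hp.one_lt.ne')
  rw [← heq, Nat.card_zpowers, hord]

/-- A nontrivial normal subgroup of a finite `p`-group contains a normal subgroup of index `p`. -/
theorem exists_normal_relIndex_eq [Finite G] {p : ℕ} (hp : p.Prime) (hG : IsPGroup p G)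
    {A : Subgroup G} (hA : A.Normal) (hA1 : A ≠ ⊥) :
    ∃ B : Subgroup G, B.Normal ∧ B ≤ A ∧ B.relIndex A = p := by
  obtain ⟨B, hB⟩ := Set.Finite.exists_maximal (s := {B : Subgroup G | B.Normal ∧ B < A})
    (Set.toFinite _) ⟨⊥, inferInstance, bot_lt_iff_ne_bot.2 hA1⟩
  have hchief := IsChiefFactor.of_covBy_normal hB.prop.1 hA hB.prop.2 fun N hN h1 h2 =>
    h2.not_ge (hB.le_of_ge ⟨hN, h1⟩ h2.le)
  exact ⟨B, hB.prop.1, hB.prop.2.le, hchief.relIndex_eq_of_isPGroup hp hG⟩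

/-- Below a subgroup `A` of order `p ^ k` normalised by a `p`-subgroup `P ≥ A`, one can descend
through subgroups normalised by `P`, each of index `p` in the previous one. -/
theorem exists_coverChain_normalised [Finite G] {p : ℕ} (hp : p.Prime) {P : Subgroup G}
    (hP : IsPGroup p P) {k : ℕ} {A : Subgroup G} (hAP : A ≤ P)
    (hA : ∀ x ∈ P, ∀ a ∈ A, x * a * x⁻¹ ∈ A) (hcard : Nat.card A = p ^ k) {j : ℕ} (hj : j ≤ k) :
    ∃ B : Subgroup G, CoverChain j A B ∧ (∀ x ∈ P, ∀ b ∈ B, x * b * x⁻¹ ∈ B) ∧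
      Nat.card B = p ^ (k - j) := by
  induction j with
  | zero => exact ⟨A, .refl A, hA, by simpa using hcard⟩
  | succ j ih =>
    obtain ⟨B, hAB, hB, hBcard⟩ := ih (by omega)
    have hBP : B ≤ P := hAB.le.trans hAP
    have hBn : (B.subgroupOf P).Normal :=
      ⟨fun b hb x => Subgroup.mem_subgroupOf.2 (hB x x.2 b (Subgroup.mem_subgroupOf.1 hb))⟩
    have hB1 : B.subgroupOf P ≠ ⊥ := by
      intro h
      rw [Subgroup.subgroupOf_eq_bot, disjoint_of_le_iff_left_eq_bot hBP] at h
      rw [h, Subgroup.card_bot] at hBcard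
      exact (Nat.one_lt_pow (by omega) hp.one_lt).ne hBcard
    obtain ⟨C, hC, hCB, hidx⟩ := exists_normal_relIndex_eq hp hP hBn hB1
    have hBmap : (B.subgroupOf P).map P.subtype = B := by
      rw [Subgroup.subgroupOf_map_subtype, inf_eq_left.2 hBP]
    have hle : C.map P.subtype ≤ B := hBmap ▸ Subgroup.map_mono hCB
    have hidx' : (C.map P.subtype).relIndex B = p := by
      rw [← hidx, ← Subgroup.relIndex_map_map_of_injective _ _ P.subtype_injective, hBmap]
    refine ⟨C.map P.subtype,
      hAB.trans (.of_covBy (covBy_of_relIndex_prime hle (hidx'.symm ▸ hp))), ?_, ?_⟩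
    · rintro x hx _ ⟨c, hc, rfl⟩
      exact ⟨_, hC.conj_mem c hc ⟨x, hx⟩, rfl⟩
    · have := Subgroup.relIndex_mul_relIndex _ _ _ bot_le hle
      rw [Subgroup.relIndex_bot_left, Subgroup.relIndex_bot_left, hidx', hBcard,
        (by omega : k - j = k - (j + 1) + 1), pow_succ] at this
      exact Nat.eq_of_mul_eq_mul_right hp.pos this

/-- A nontrivial finite soluble group has a nontrivial normal subgroup of prime power order. -/
theorem exists_normal_isPGroup [Finite G] [Nontrivial G] (hG : Group.IsSolvable G) :
    ∃ (q : ℕ) (S : Subgroup G), q.Prime ∧ S.Normal ∧ S ≠ ⊥ ∧ IsPGroup q S := by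
  obtain ⟨A, hA⟩ := Set.Finite.exists_minimal (s := {A : Subgroup G | A.Normal ∧ A ≠ ⊥})
    (Set.toFinite _) ⟨⊤, inferInstance, top_ne_bot⟩
  have hAn := hA.prop.1
  have hlt := Group.IsSolvable.commutator_lt_of_ne_bot hA.prop.2
  have hcomm : ⁅A, A⁆ = ⊥ := by
    by_contra h
    exact hlt.not_ge (hA.le_of_le ⟨inferInstance, h⟩ hlt.le)
  rw [Subgroup.commutator_eq_bot_iff_le_centralizer] at hcomm
  obtain ⟨q, hq, hdvd⟩ := Nat.exists_prime_and_dvd (mt Subgroup.card_eq_one.1 hA.prop.2)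
  have : Fact q.Prime := ⟨hq⟩
  let S : Subgroup G :=
    { carrier := {a | a ∈ A ∧ a ^ q = 1}
      one_mem' := ⟨A.one_mem, one_pow q⟩
      mul_mem' := fun {a b} ha hb => ⟨A.mul_mem ha.1 hb.1, by
        have h : Commute a b := (Subgroup.mem_centralizer_iff.1 (hcomm hb.1) a ha.1)
        rw [h.mul_pow, ha.2, hb.2, one_mul]⟩
      inv_mem' := fun {a} ha => ⟨A.inv_mem ha.1, by rw [inv_pow, ha.2, inv_one]⟩ }
  refine ⟨q, S, hq, ⟨fun a ha g => ⟨hAn.conj_mem a ha.1 g, ?_⟩⟩, ?_, ?_⟩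
  · rw [conj_pow, ha.2, mul_one, mul_inv_cancel]
  · obtain ⟨x, hx⟩ := exists_prime_orderOf_dvd_card' q hdvd
    intro hS
    have hxS : (x : G) ∈ S := ⟨x.2, by
      rw [← Subgroup.coe_pow, ← hx, pow_orderOf_eq_one, Subgroup.coe_one]⟩
    rw [hS, Subgroup.mem_bot, OneMemClass.coe_eq_one] at hxS
    rw [hxS, orderOf_one] at hx
    exact hq.one_lt.ne hx
  · rw [isPGroup_iff_pow_pow_eq_one]
    exact fun g => ⟨1, Subtype.ext (by simpa using g.2.2)⟩

end ChiefFactors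

/-! ### Inheritance of the hypothesis on `n`-maximal subgroups -/

section Inheritance

variable {G : Type*} [Group G]

theorem isNMaximal_iff_coverChain {n : ℕ} {H : Subgroup G} : IsNMaximal n H ↔ CoverChain n ⊤ H :=
  Iff.rfl

theorem isSQuasinormal_of_isNMaximal_quotient [Finite G] (K : Subgroup G) [K.Normal] {n : ℕ}
    (h : ∀ H : Subgroup G, IsNMaximal n H → IsSQuasinormal H) (H : Subgroup (G ⧸ K))
    (hH : IsNMaximal n H) : IsSQuasinormal H := by
  have hs := QuotientGroup.mk'_surjective K
  rw [← Subgroup.map_comap_eq_self_of_surjective hs H]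
  refine (h _ ?_).map hs
  have := CoverChain.map (Subgroup.comap (QuotientGroup.mk' K))
    (fun _ _ hXY _ => covBy_comap hs hXY) (isNMaximal_iff_coverChain.1 hH)
  rwa [Subgroup.comap_top] at this

theorem isSQuasinormal_of_isNMaximal_coatom [Finite G] {M : Subgroup G} (hM : IsCoatom M) {n : ℕ}
    (h : ∀ H : Subgroup G, IsNMaximal (1 + n) H → IsSQuasinormal H) (H : Subgroup M)
    (hH : IsNMaximal n H) : IsSQuasinormal H := by
  have h1 := CoverChain.map (Subgroup.map M.subtype)
    (fun _ _ hXY _ => covBy_map_subtype hXY) (isNMaximal_iff_coverChain.1 hH)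
  rw [← MonoidHom.range_eq_map, Subgroup.range_subtype] at h1
  have h2 := h _ ((CoverChain.of_covBy (covBy_top_iff.2 hM)).trans h1)
  have h3 := h2.subgroupOf (Subgroup.map_subtype_le H)
  rwa [Subgroup.subgroupOf, Subgroup.comap_map_eq_self_of_injective M.subtype_injective] at h3

end Inheritance

/-! ### Normality criteria -/

section Normality

variable {G : Type*} [Group G]

theorem le_normalizer_of_conj_mem {A X : Subgroup G} (h : ∀ x ∈ A, ∀ a ∈ X, x * a * x⁻¹ ∈ X) :
    A ≤ Subgroup.normalizer (X : Set G) := by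
  intro x hx
  refine Subgroup.mem_normalizer_iff.2 fun a => ⟨h x hx a, fun ha => ?_⟩
  have := h x⁻¹ (A.inv_mem hx) _ ha
  rwa [(by group : x⁻¹ * (x * a * x⁻¹) * x⁻¹⁻¹ = a)] at this

theorem normal_of_sup_eq_top {A B X : Subgroup G} (h : A ⊔ B = ⊤)
    (hA : ∀ x ∈ A, ∀ a ∈ X, x * a * x⁻¹ ∈ X) (hB : ∀ x ∈ B, ∀ a ∈ X, x * a * x⁻¹ ∈ X) :
    X.Normal := by
  rw [← Subgroup.normalizer_eq_top_iff, eq_top_iff, ← h]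
  exact sup_le (le_normalizer_of_conj_mem hA) (le_normalizer_of_conj_mem hB)

theorem normal_of_forall_sylow [Finite G] {X : Subgroup G}
    (h : ∀ q : ℕ, q.Prime → ∃ Q : Sylow q G, ∀ x ∈ Q, ∀ a ∈ X, x * a * x⁻¹ ∈ X) : X.Normal := by
  rw [← Subgroup.normalizer_eq_top_iff]
  refine eq_top_of_forall_sylow_le _ fun q hq => ?_
  obtain ⟨Q, hQ⟩ := h q hq
  exact ⟨Q, le_normalizer_of_conj_mem hQ⟩

/-- A maximal `S`-quasinormal subgroup `M` is normal: its index is a power of a prime `p`, so it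
contains all Sylow `q`-subgroups with `q ≠ p`, and the quotient by its core is a `p`-group. -/
theorem IsSQuasinormal.normal_of_isCoatom [Finite G] {M : Subgroup G} (hM : IsCoatom M)
    (hMS : IsSQuasinormal M) : M.Normal := by
  obtain ⟨p, hp, P, hPM⟩ : ∃ p : ℕ, p.Prime ∧ ∃ P : Sylow p G, ¬ (P : Subgroup G) ≤ M := by
    by_contra! h
    exact hM.1 (eq_top_of_forall_sylow_le M fun q hq => ⟨default, h q hq _⟩)
  have : Fact p.Prime := ⟨hp⟩
  obtain ⟨T, hMT, hPT, m, hm⟩ := hMS.exists_sup_relIndex hp P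
  obtain rfl : T = ⊤ := hM.2 _ (lt_of_le_of_ne hMT fun e => hPM (e ▸ hPT))
  have hcore : ∀ q : ℕ, q.Prime → q ≠ p → ∀ Q : Sylow q G, (Q : Subgroup G) ≤ M.normalCore := by
    intro q hq hqp Q x hx g
    obtain ⟨l, hl⟩ := Q.isPGroup'.exists_pow_pow_eq_one ⟨x, hx⟩
    have hl' : x ^ q ^ l = 1 := congrArg Subtype.val hl
    refine hMS.mem_of_relIndex_eq_pow hMT hp hq hqp hm (z := g * x * g⁻¹) (m := l) trivial ?_
    rw [conj_pow, hl', mul_one, mul_inv_cancel]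
  have hs := QuotientGroup.mk'_surjective M.normalCore
  have hQ : IsPGroup p (G ⧸ M.normalCore) := by
    rw [isPGroup_iff_primeFactors_card_subset hp.ne_zero]
    intro q hq
    rw [hp.primeFactors, Finset.mem_singleton]
    -- A Sylow `q`-subgroup of the quotient is the image of one of `G`, which lies in the core.
    by_contra hqp
    have hq' := Nat.prime_of_mem_primeFactors hq
    have : Fact q.Prime := ⟨hq'⟩
    obtain ⟨R⟩ : Nonempty (Sylow q (G ⧸ M.normalCore)) := inferInstance
    obtain ⟨Q, rfl⟩ := Sylow.mapSurjective_surjective hs q R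
    refine Sylow.ne_bot_of_dvd_card (Q.mapSurjective hs) (Nat.dvd_of_mem_primeFactors hq) ?_
    rw [Sylow.coe_mapSurjective, Subgroup.map_eq_bot_iff, QuotientGroup.ker_mk']
    exact hcore q hq' hqp Q
  have hnil : Group.IsNilpotent (G ⧸ M.normalCore) := hQ.isNilpotent
  have hcm : (M.map (QuotientGroup.mk' M.normalCore)).comap (QuotientGroup.mk' M.normalCore) = M :=
    Subgroup.comap_map_eq_self (by simpa using M.normalCore_le)
  have hco : IsCoatom (M.map (QuotientGroup.mk' M.normalCore)) := by
    refine ⟨fun h => hM.1 ?_, fun X hX => ?_⟩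
    · rw [← hcm, h, Subgroup.comap_top]
    · rw [← Subgroup.comap_lt_comap_of_surjective hs, hcm] at hX
      exact Subgroup.comap_injective hs ((hM.2 _ hX).trans (Subgroup.comap_top _).symm)
  have hn := Subgroup.NormalizerCondition.normal_of_coatom _
    Group.normalizerCondition_of_isNilpotent hco
  rw [← hcm]
  exact hn.comap _

end Normality

/-! ### Minimal normal subgroups of prime power order -/

section MinimalNormal

variable {G : Type*} [Group G] [Finite G] {N : Subgroup G} {p k : ℕ}

/-- A central minimal normal subgroup has prime order. -/
theorem IsChiefFactor.exponent_le_one_of_central (hN : IsChiefFactor ⊥ N) (hp : p.Prime)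
    (hcard : Nat.card N = p ^ k) (hC : Subgroup.centralizer (N : Set G) = ⊤) : k ≤ 1 := by
  have : Fact p.Prime := ⟨hp⟩
  have := hN.normal_top
  by_contra hk
  obtain ⟨B, hB, -, hBcard⟩ := exists_coverChain_normalised hp (IsPGroup.of_card hcard) le_rfl
    (fun x _ a ha => hN.normal_top.conj_mem a ha x) hcard (j := 1) (by omega)
  have hBN := hB.lt one_ne_zero
  have hBnorm : B.Normal := ⟨fun b hb g => by
    have hg : g ∈ Subgroup.centralizer (N : Set G) := hC ▸ Subgroup.mem_top g
    rw [← Subgroup.mem_centralizer_iff.1 hg b (hBN.le hb), mul_inv_cancel_right]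
    exact hb⟩
  refine hBN.ne (hN.eq_of_le hBnorm hBN.le fun e => ?_)
  rw [e, Subgroup.card_bot] at hBcard
  exact (Nat.one_lt_pow (by omega) hp.one_lt).ne hBcard

/-- A chain of length `t < n` from `G` to `N` extends to a chain of length `n` ending at a subgroup
of `N` of order `p ^ (k - (n - t))` normalised by a Sylow `p`-subgroup. This subgroup is normalised
by the other Sylow subgroups as well, so it is normal in `G`, hence trivial. -/
theorem IsChiefFactor.lt_of_coverChain (hN : IsChiefFactor ⊥ N) (hp : p.Prime)
    (hcard : Nat.card N = p ^ k) {n t : ℕ}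
    (h : ∀ H : Subgroup G, IsNMaximal n H → IsSQuasinormal H)
    (ht : CoverChain t ⊤ N) (ht0 : t ≠ 0) (htn : t < n) : k < n := by
  have : Fact p.Prime := ⟨hp⟩
  have := hN.normal_top
  by_contra! hk
  have hNp : IsPGroup p N := IsPGroup.of_card hcard
  obtain ⟨P, hNP⟩ := hNp.exists_le_sylow
  obtain ⟨B, hB, hBP, hBcard⟩ := exists_coverChain_normalised hp P.isPGroup' hNP
    (fun x _ a ha => hN.normal_top.conj_mem a ha x) hcard (j := n - t) (by omega)
  have hBN : B < N := hB.lt (by omega)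
  have hBS : IsSQuasinormal B := h B (by
    have := ht.trans hB
    rwa [Nat.add_sub_cancel' htn.le] at this)
  have hBnorm : B.Normal := by
    refine normal_of_forall_sylow fun q hq => ?_
    by_cases hqp : q = p
    · subst hqp
      exact ⟨P, hBP⟩
    · exact ⟨default, fun x hx a ha => hBS.conj_mem hp hq hqp hNp hBN.le default hx ha⟩
  refine hBN.ne (hN.eq_of_le hBnorm hBN.le fun e => ?_)
  rw [e, Subgroup.card_bot] at hBcard
  exact (Nat.one_lt_pow (by omega) hp.one_lt).ne hBcard

/-- If all maximal subgroups are `S`-quasinormal then `G` is nilpotent, so that minimal normal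
subgroups are central. -/
theorem IsChiefFactor.exponent_le_one (hN : IsChiefFactor ⊥ N) (hp : p.Prime)
    (hcard : Nat.card N = p ^ k)
    (h : ∀ H : Subgroup G, IsNMaximal 1 H → IsSQuasinormal H) : k ≤ 1 := by
  have h1 : ∀ M : Subgroup G, IsCoatom M → M.Normal := fun M hM =>
    (h M (CoverChain.of_covBy (covBy_top_iff.2 hM))).normal_of_isCoatom hM
  have h2 := ((Group.isNilpotent_of_finite_tfae (G := G)).out 2 3).1 h1
  refine hN.exponent_le_one_of_central hp hcard (eq_top_of_forall_sylow_le _ fun q hq => ?_)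
  exact ⟨default, hN.le_centralizer hp hq (IsPGroup.of_card hcard) (h2 q ⟨hq⟩ default)
    (default : Sylow q G).isPGroup'⟩

end MinimalNormal

/-! ### Faithful complemented minimal normal subgroups -/

section Complement

variable {G : Type*} [Group G] [Finite G] {N M : Subgroup G} {p k n : ℕ}

theorem relIndex_sup_of_disjoint [N.Normal] {H : Subgroup G} (h : N ⊓ H = ⊥) :
    H.relIndex (H ⊔ N) = Nat.card N := by
  have h1 := Subgroup.relIndex_mul_relIndex ⊥ H (H ⊔ N) bot_le le_sup_left
  have h2 := Subgroup.relIndex_mul_relIndex ⊥ N (H ⊔ N) bot_le le_sup_right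
  rw [Subgroup.relIndex_sup_right, ← Subgroup.inf_relIndex_right N H, h] at h2
  simp only [Subgroup.relIndex_bot_left] at h1 h2
  exact Nat.eq_of_mul_eq_mul_left Nat.card_pos (h1.trans (h2.symm.trans (mul_comm _ _)))

/-- An `S`-quasinormal subgroup `H` of a complement of the normal `p`-subgroup `N` contains, with
each element of `q`-power order, `q ≠ p`, all its `N`-conjugates; hence that element centralises
`N`. -/
theorem IsSQuasinormal.mem_centralizer_of_disjoint [N.Normal] {H : Subgroup G}
    (hH : IsSQuasinormal H) (hHN : N ⊓ H = ⊥) {q m : ℕ} (hp : p.Prime) (hq : q.Prime)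
    (hqp : q ≠ p) (hcard : Nat.card N = p ^ k) {x : G} (hx : x ∈ H) (hxq : x ^ q ^ m = 1) :
    x ∈ Subgroup.centralizer (N : Set G) := by
  refine Subgroup.mem_centralizer_iff.2 fun y hy => ?_
  have hz : y * x * y⁻¹ ∈ H := by
    have hyT : y ∈ H ⊔ N := Subgroup.mem_sup_right hy
    refine hH.mem_of_relIndex_eq_pow (T := H ⊔ N) le_sup_left hp hq hqp
      ((relIndex_sup_of_disjoint hHN).trans hcard) (m := m) ?_ ?_
    · exact mul_mem (mul_mem hyT (Subgroup.mem_sup_left hx)) (inv_mem hyT)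
    · rw [conj_pow, hxq, mul_one, mul_inv_cancel]
  have h1 : y * x * y⁻¹ * x⁻¹ ∈ N ⊓ H := by
    refine ⟨?_, H.mul_mem hz (H.inv_mem hx)⟩
    have : y * x * y⁻¹ * x⁻¹ = y * (x * y⁻¹ * x⁻¹) := by group
    rw [this]
    exact N.mul_mem hy (Subgroup.Normal.conj_mem inferInstance _ (N.inv_mem hy) x)
  rw [hHN, Subgroup.mem_bot] at h1
  exact mul_inv_eq_iff_eq_mul.1 (mul_inv_eq_one.1 h1)

/-- The case of a minimal normal subgroup `N` with a maximal complement `M` acting faithfully.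
Refine `M ≥ K ≥ 1` to a chain of coverings, where `K` is a normal subgroup of `M` of prime power
order. If the chain is short, it yields a chain from `G` to `N` of length less than `n`. Otherwise
its term that is `n`-maximal in `G` meets `K` nontrivially, which contradicts faithfulness. -/
theorem IsChiefFactor.exponent_le_of_faithful (hG : Group.IsSolvable G) (hN : IsChiefFactor ⊥ N)
    (hp : p.Prime) (hcard : Nat.card N = p ^ k) (hM : IsCoatom M) (hNM : ¬ N ≤ M)
    (hfaithful : M ⊓ Subgroup.centralizer (N : Set G) = ⊥) (hn : n ≠ 0)
    (h : ∀ H : Subgroup G, IsNMaximal n H → IsSQuasinormal H) : k ≤ max 1 (n - 1) := by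
  have : Fact p.Prime := ⟨hp⟩
  have hNn := hN.normal_top
  have hNp : IsPGroup p N := IsPGroup.of_card hcard
  have hNC := hN.le_centralizer hp hp hNp hNn hNp
  have hsup : M ⊔ N = ⊤ := hM.2 _ (left_lt_sup.2 hNM)
  have hMN : M ⊓ N = ⊥ := le_bot_iff.1 (hfaithful ▸ inf_le_inf_left M hNC)
  by_cases hM1 : M = ⊥
  · rw [hM1, bot_sup_eq] at hsup
    exact (hN.exponent_le_one_of_central hp hcard (top_le_iff.1 (hsup ▸ hNC))).trans
      (le_max_left _ _)
  have : Nontrivial M := (Subgroup.nontrivial_iff_ne_bot M).2 hM1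
  obtain ⟨q, S, hq, hS, hS1, hSq⟩ := exists_normal_isPGroup (G := M) inferInstance
  set K := S.map M.subtype with hK
  have hKM : K ≤ M := Subgroup.map_subtype_le S
  have hK1 : K ≠ ⊥ := by
    rwa [hK, Ne, Subgroup.map_eq_bot_iff_of_injective _ M.subtype_injective]
  have hKq : IsPGroup q K := hSq.map _
  have hKconj : ∀ x ∈ M, ∀ a ∈ K, x * a * x⁻¹ ∈ K := by
    rintro x hx _ ⟨a, ha, rfl⟩
    exact ⟨_, hS.conj_mem a ha ⟨x, hx⟩, rfl⟩
  have hqp : q ≠ p := by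
    rintro rfl
    have hKN : (K ⊔ N).Normal := by
      refine normal_of_sup_eq_top hsup (fun x hx a ha => ?_) fun x hx a ha => ?_
      · obtain ⟨b, hb, c, hc, rfl⟩ := Subgroup.mem_sup_of_normal_right.1 ha
        rw [(by group : x * (b * c) * x⁻¹ = (x * b * x⁻¹) * (x * c * x⁻¹))]
        exact Subgroup.mul_mem_sup (hKconj x hx b hb) (hNn.conj_mem c hc x)
      · have hx' : x ∈ K ⊔ N := Subgroup.mem_sup_right hx
        exact mul_mem (mul_mem hx' ha) (inv_mem hx')
    have := hN.le_centralizer hp hp hNp hKN (hKq.to_sup_of_normal_right hNp)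
    exact hK1 (le_bot_iff.1 (hfaithful ▸ le_inf hKM (le_sup_left.trans this)))
  have key : ∀ H : Subgroup G, CoverChain (n - 1) M H → H ⊓ K = ⊥ := by
    intro H hH
    have hHS : IsSQuasinormal H := h H (by
      have := (CoverChain.of_covBy (covBy_top_iff.2 hM)).trans hH
      rwa [Nat.add_sub_cancel' (Nat.one_le_iff_ne_zero.2 hn)] at this)
    have hHN : N ⊓ H = ⊥ := le_bot_iff.1 (by
      rw [inf_comm, ← hMN]
      exact inf_le_inf_right N hH.le)
    refine (Subgroup.eq_bot_iff_forall _).2 fun x hx => ?_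
    obtain ⟨l, hl⟩ := hKq.exists_pow_pow_eq_one ⟨x, hx.2⟩
    have hxC := hHS.mem_centralizer_of_disjoint hHN hp hq hqp hcard hx.1
      (congrArg Subtype.val hl : x ^ q ^ l = 1)
    rw [← Subgroup.mem_bot, ← hfaithful]
    exact ⟨hKM hx.2, hxC⟩
  obtain ⟨s, hs⟩ := CoverChain.exists_of_le hKM
  obtain ⟨r, hr⟩ := CoverChain.exists_of_le (bot_le : ⊥ ≤ K)
  -- The map `X ↦ X ⊔ N` turns the chain from `M` to `⊥` into a chain from `G` to `N`.
  by_cases hlen : s + r ≤ n - 1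
  · have hchain := (hs.trans hr).map (fun X => X ⊔ N)
      fun _ _ hXY hY => covBy_sup_of_disjoint hMN hY hXY
    simp only [hsup, bot_sup_eq] at hchain
    have h0 : s + r ≠ 0 := by
      intro h0
      rw [h0] at hchain
      obtain ⟨x, hx0, hx1, -⟩ := hchain
      have hNtop : N = ⊤ := hx1.symm.trans hx0
      exact hM1 (by rw [← hMN, hNtop, inf_top_eq])
    have := hN.lt_of_coverChain hp hcard h hchain h0 (by omega)
    exact (by omega : k ≤ n - 1).trans (le_max_right _ _)
  · exfalso
    by_cases hsn : n - 1 ≤ s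
    · rw [← Nat.add_sub_cancel' hsn] at hs
      obtain ⟨H, hH, hHK⟩ := hs.split
      exact hK1 (by rw [← key H hH, inf_eq_right.2 hHK.le])
    · obtain ⟨j, hj⟩ := Nat.exists_eq_add_of_le (by omega : s ≤ n - 1)
      obtain ⟨i, hi⟩ := Nat.exists_eq_add_of_le (by omega : j ≤ r)
      rw [hi] at hr
      obtain ⟨H, hKH, hH⟩ := hr.split
      refine (hH.lt (by omega)).ne' ?_
      rw [← key H (hj ▸ hs.trans hKH), inf_eq_left.2 hKH.le]

end Complement

/-! ### The bound on chief factors -/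

section Bound

variable {G : Type*} [Group G] {N M : Subgroup G} {p k n : ℕ}

/-- If the maximal subgroup `M` does not contain the normal subgroup `N`, and `D` is the
centraliser of `N` in `M`, then `DN / D` is a chief factor isomorphic to `N`. -/
theorem IsChiefFactor.sup_inf_centralizer [Finite G] (hN : IsChiefFactor ⊥ N) (hp : p.Prime)
    (hNp : IsPGroup p N) (hM : IsCoatom M) (hNM : ¬ N ≤ M) :
    IsChiefFactor (M ⊓ Subgroup.centralizer (N : Set G))
        ((M ⊓ Subgroup.centralizer (N : Set G)) ⊔ N) ∧
      (M ⊓ Subgroup.centralizer (N : Set G)).relIndex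
        ((M ⊓ Subgroup.centralizer (N : Set G)) ⊔ N) = Nat.card N := by
  have hNn := hN.normal_top
  have hNC := hN.le_centralizer hp hp hNp hNn hNp
  have hsup : M ⊔ N = ⊤ := hM.2 _ (left_lt_sup.2 hNM)
  set D := M ⊓ Subgroup.centralizer (N : Set G) with hD
  have hDn : D.Normal := by
    refine normal_of_sup_eq_top hsup (fun x hx a ha => ⟨?_, ?_⟩) fun x hx a ha => ?_
    · exact M.mul_mem (M.mul_mem hx ha.1) (M.inv_mem hx)
    · exact Subgroup.Normal.conj_mem inferInstance a ha.2 x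
    · rwa [Subgroup.mem_centralizer_iff.1 ha.2 x hx, mul_inv_cancel_right]
  have hND : N ⊓ D = ⊥ := by
    by_contra hne
    have := hN.eq_of_le inferInstance inf_le_left hne
    exact hNM ((inf_eq_left.1 this).trans inf_le_left)
  refine ⟨⟨hDn, inferInstance, left_lt_sup.2 fun hle => ?_, fun X hX hDX hXT => ?_⟩,
    relIndex_sup_of_disjoint hND⟩
  · exact hNM (hle.trans inf_le_left)
  · by_cases hXN : X ⊓ N = ⊥
    · refine Or.inl (le_antisymm (fun x hx => ?_) hDX)
      obtain ⟨d, hd, y, hy, rfl⟩ := Subgroup.mem_sup_of_normal_right.1 (hXT hx)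
      have hy' : y ∈ X ⊓ N :=
        ⟨by simpa using X.mul_mem (X.inv_mem (hDX hd)) hx, hy⟩
      rw [hXN, Subgroup.mem_bot] at hy'
      simpa [hy'] using hd
    · have := hN.eq_of_le inferInstance inf_le_right hXN
      exact Or.inr (le_antisymm hXT (sup_le hDX (inf_eq_right.1 this)))

/-- A minimal normal subgroup of `G` contained in `M`, where `G = M C` and `C` centralises `N`, is
minimal normal in `M`. -/
theorem IsChiefFactor.subgroupOf (hN : IsChiefFactor ⊥ N) (hNM : N ≤ M)
    (hMC : M ⊔ Subgroup.centralizer (N : Set G) = ⊤) : IsChiefFactor ⊥ (N.subgroupOf M) := by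
  have hNn := hN.normal_top
  refine ⟨inferInstance, inferInstance, bot_lt_iff_ne_bot.2 fun hb => ?_, fun X hX _ hXN => ?_⟩
  · rw [Subgroup.subgroupOf_eq_bot, disjoint_of_le_iff_left_eq_bot hNM] at hb
    exact hN.lt.ne' hb
  · have hle : X.map M.subtype ≤ N := by
      rintro _ ⟨x, hx, rfl⟩
      exact Subgroup.mem_subgroupOf.1 (hXN hx)
    have hn : (X.map M.subtype).Normal := by
      refine normal_of_sup_eq_top hMC ?_ fun x hx a ha => ?_
      · rintro x hx _ ⟨a, ha, rfl⟩
        exact ⟨_, hX.conj_mem a ha ⟨x, hx⟩, rfl⟩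
      · rwa [← Subgroup.mem_centralizer_iff.1 hx a (hle ha), mul_inv_cancel_right]
    refine (hN.eq_or_eq _ hn bot_le hle).imp (fun e => ?_) fun e => ?_
    · exact (Subgroup.map_eq_bot_iff_of_injective _ M.subtype_injective).1 e
    · rw [← e, Subgroup.subgroupOf, Subgroup.comap_map_eq_self_of_injective M.subtype_injective]

/-- In a soluble group, the centraliser of a minimal normal subgroup of prime power order is `G` or
is not contained in some maximal subgroup: otherwise, by the Frattini argument, a normal subgroup of
prime power order of `G ⧸ C`, with `C` the centraliser, would give a normal subgroup of prime power
order of `G` not contained in `C`. -/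
theorem IsChiefFactor.exists_coatom_not_le [Finite G] (hG : Group.IsSolvable G)
    (hN : IsChiefFactor ⊥ N) (hp : p.Prime) (hNp : IsPGroup p N)
    (hC : Subgroup.centralizer (N : Set G) ≠ ⊤) :
    ∃ M : Subgroup G, IsCoatom M ∧ ¬ Subgroup.centralizer (N : Set G) ≤ M := by
  by_contra! hall
  have hNn := hN.normal_top
  set C := Subgroup.centralizer (N : Set G) with hCdef
  have : Nontrivial (G ⧸ C) := QuotientGroup.nontrivial_iff.2 hC
  have hs := QuotientGroup.mk'_surjective C
  obtain ⟨q, S, hq, hS, hS1, hSq⟩ := exists_normal_isPGroup (G := G ⧸ C) inferInstance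
  have : Fact q.Prime := ⟨hq⟩
  let E := S.comap (QuotientGroup.mk' C)
  have hE : E.Normal := hS.comap _
  have hCE : C ≤ E := by
    simpa [E] using MonoidHom.ker_le_comap (QuotientGroup.mk' C) S
  obtain ⟨R⟩ : Nonempty (Sylow q E) := inferInstance
  set T := (R : Subgroup E).map E.subtype with hT
  have hTE : T ≤ E := Subgroup.map_subtype_le _
  -- The image of `T` in `G ⧸ C` is a Sylow subgroup of the `q`-group `S`, so it is `S` itself.
  have hET : E ≤ T ⊔ C := by
    have hidx : ¬ q ∣ (T ⊔ C).relIndex E := fun hd => by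
      refine R.not_dvd_index (hd.trans ?_)
      have := Subgroup.relIndex_dvd_of_le_left E (le_sup_left : T ≤ T ⊔ C)
      refine this.trans (dvd_of_eq ?_)
      rw [Subgroup.relIndex, hT, Subgroup.subgroupOf,
        Subgroup.comap_map_eq_self_of_injective E.subtype_injective]
    have hpow : (T ⊔ C).relIndex E ∣ Nat.card S := by
      refine (Subgroup.relIndex_dvd_of_le_left E (le_sup_right : C ≤ T ⊔ C)).trans
        (dvd_of_eq ?_)
      rw [← card_map_mk, Subgroup.map_comap_eq_self_of_surjective hs]
    obtain ⟨m, hm⟩ := IsPGroup.iff_card.1 hSq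
    rw [hm] at hpow
    obtain ⟨i, -, hi⟩ := (Nat.dvd_prime_pow hq).1 hpow
    refine Subgroup.relIndex_eq_one.1 (hi.trans ?_)
    rcases i with _ | i
    · rfl
    · exact absurd (hi ▸ dvd_pow_self q i.succ_ne_zero) hidx
  have hnorm : Subgroup.normalizer (T : Set G) = ⊤ := by
    by_contra hne
    obtain ⟨M, hM, hle⟩ := (eq_top_or_exists_le_coatom _).resolve_left hne
    have hfr : Subgroup.normalizer (T : Set G) ⊔ E = ⊤ := Sylow.normalizer_sup_eq_top R
    refine hM.1 (top_le_iff.1 (hfr ▸ sup_le hle (hET.trans (sup_le ?_ (hall M hM)))))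
    exact Subgroup.le_normalizer.trans hle
  have hTn : T.Normal := Subgroup.normalizer_eq_top_iff.1 hnorm
  have hTC : T ≤ C := hN.le_centralizer hp hq hNp hTn (R.isPGroup'.map _)
  refine hS1 (le_bot_iff.1 ?_)
  rw [← Subgroup.map_comap_eq_self_of_surjective hs S, le_bot_iff, Subgroup.map_eq_bot_iff,
    QuotientGroup.ker_mk']
  exact hET.trans (sup_le hTC le_rfl)

end Bound

universe u

/-- The bound on the order of chief factors, for groups of order at most `m`, by induction on `m`.
It is stated for all `n ≥ 1`, so that the passage from `(G, n)` to `(M, n - 1)` for a maximal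
subgroup `M` stays within its scope; this is why `1` appears in the maximum. -/
theorem exponent_le_of_card_le (m : ℕ) : ∀ (G : Type u) [Group G] [Finite G], Nat.card G ≤ m →
    Group.IsSolvable G → ∀ n : ℕ, n ≠ 0 →
    (∀ H : Subgroup G, IsNMaximal n H → IsSQuasinormal H) →
    ∀ (p k : ℕ) (K H : Subgroup G), p.Prime → IsChiefFactor K H → K.relIndex H = p ^ k →
    k ≤ max 1 (n - 1) := by
  induction m with
  | zero => exact fun G _ _ hm => absurd hm (by simpa using Nat.card_pos.ne')
  | succ m ih =>
    intro G _ _ hm hG n hn h p k K H hp hKH hidx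
    have hquot : ∀ K H : Subgroup G, IsChiefFactor K H → K.relIndex H = p ^ k → K ≠ ⊥ →
        k ≤ max 1 (n - 1) := by
      intro K H hKH hidx hK
      have := hKH.normal_bot
      refine ih (G ⧸ K) ?_ inferInstance n hn (isSQuasinormal_of_isNMaximal_quotient K h) p k ⊥
        (H.map (QuotientGroup.mk' K)) hp hKH.map_mk ?_
      · have h1 := K.card_eq_card_quotient_mul_card_subgroup
        have h2 : 1 < Nat.card K := Subgroup.one_lt_card_iff_ne_bot K |>.2 hK
        have h3 : 0 < Nat.card (G ⧸ K) := Nat.card_pos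
        have : Nat.card (G ⧸ K) < Nat.card G := by rw [h1]; exact lt_mul_of_one_lt_right h3 h2
        omega
      · rw [Subgroup.relIndex_bot_left, card_map_mk, hidx]
    by_cases hK : K ≠ ⊥
    · exact hquot K H hKH hidx hK
    obtain rfl := not_not.1 hK
    rw [Subgroup.relIndex_bot_left] at hidx
    have hHp : IsPGroup p H := IsPGroup.of_card hidx
    by_cases hC : Subgroup.centralizer (H : Set G) = ⊤
    · exact (hKH.exponent_le_one_of_central hp hidx hC).trans (le_max_left _ _)
    obtain ⟨M, hM, hMC⟩ := hKH.exists_coatom_not_le hG hp hHp hC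
    by_cases hHM : H ≤ M
    -- `G = M C` with `C` the centraliser of `H`, so `H` is minimal normal in `M`.
    · obtain ⟨n, rfl⟩ := Nat.exists_eq_add_of_le (Nat.one_le_iff_ne_zero.2 hn)
      by_cases hn0 : n = 0
      · subst hn0
        exact (hKH.exponent_le_one hp hidx h).trans (le_max_left _ _)
      have hcardM : Nat.card M < Nat.card G :=
        lt_of_le_of_ne (Subgroup.card_le_card_group M) fun e => hM.1 (Subgroup.eq_top_of_card_eq M e)
      have := ih M (by omega) inferInstance n hn0 (isSQuasinormal_of_isNMaximal_coatom hM h) p k ⊥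
        (H.subgroupOf M) hp (hKH.subgroupOf hHM (hM.2 _ (left_lt_sup.2 hMC))) (by
          rw [Subgroup.relIndex_bot_left, ← hidx]
          exact Nat.card_congr (Subgroup.subgroupOfEquivOfLe hHM).toEquiv)
      omega
    · by_cases hD : M ⊓ Subgroup.centralizer (H : Set G) = ⊥
      · exact hKH.exponent_le_of_faithful hG hp hidx hM hHM hD hn h
      · obtain ⟨h1, h2⟩ := hKH.sup_inf_centralizer hp hHp hM hHM
        exact hquot _ _ h1 (h2.trans hidx) hD

end SQuasi

theorem corollary1p3 {G : Type*} [Group G] [Finite G] (hG : Group.IsSolvable G) (n : ℕ) (hn : 1 < n)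
    (hmax : ∀ H : Subgroup G, SQuasi.IsNMaximal n H → SQuasi.IsSQuasinormal H) :
    SQuasi.rank G ≤ n - 1 := by
  refine csSup_le' ?_
  rintro k ⟨p, hp, K, H, hKH, hidx⟩
  have := SQuasi.exponent_le_of_card_le _ G le_rfl hG n (by omega) hmax p k K H hp hKH hidx
  omega
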